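/- Let $S$ be an infinite set, let $(R_k)_{k\in S}$ be a family of nonzero commutative rings, each having only finitely many idempotents, and let $R=\prod_{k\in S}R_k$ with projections $\pi_k:R\to R_k$. A prime ideal of $R$ is called tame if it is of the form $\pi_k^{-1}(\mathfrak p)$ for some $k\in S$ and some prime ideal $\mathfrak p$ of $R_k$, and wild otherwise. An ideal is called regular if it is generated by a set of idempotents, and a maximal element of the set of proper regular ideals of $R$ is called a max-regular ideal; a max-regular ideal $M$ is called wild if every prime in $V(M)=\{P\in\operatorname{Spec}(R): M\subseteq P\}$ is wild. A connected component of $\operatorname{Spec}(R)$ is called wild if all of its points are wild primes. Then the set of wild max-regular ideals of $R$ has cardinality $2^{2^{|S|}}$. Moreover, $M\mapsto V(M)$ is a bijection from the set of wild max-regular ideals of $R$ onto the set of wild connected components of $\operatorname{Spec}(R)$, so the latter set also has cardinality $2^{2^{|S|}}$. -/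

import Mathlib

universe u v

/-- A regular ideal: an ideal generated by a set of idempotents. -/
def IsRegularIdeal {A : Type*} [CommRing A] (I : Ideal A) : Prop :=
  ∃ E : Set A, (∀ e ∈ E, IsIdempotentElem e) ∧ I = Ideal.span E

/-- A max-regular ideal: a maximal element of the set of proper regular ideals. -/
def IsMaxRegularIdeal {A : Type*} [CommRing A] (M : Ideal A) : Prop :=
  Maximal (fun I : Ideal A => IsRegularIdeal I ∧ I ≠ ⊤) M

section Product

variable {S : Type u} (R : S → Type v) [∀ k, CommRing (R k)]

/-- The tame primes of `∏ R k`: the preimages of primes of the factors under the projections. -/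
def tamePrimes : Set (PrimeSpectrum (∀ k, R k)) :=
  {P | ∃ (k : S) (p : PrimeSpectrum (R k)), P = PrimeSpectrum.comap (Pi.evalRingHom R k) p}

/-- The wild primes of `∏ R k`: the primes that are not tame. -/
def wildPrimes : Set (PrimeSpectrum (∀ k, R k)) :=
  {P | P ∉ tamePrimes R}

/-- The wild max-regular ideals of `∏ R k`: the max-regular ideals `M` such that every prime
containing `M` is wild. -/
def wildMaxRegularIdeals : Set (Ideal (∀ k, R k)) :=
  {M | IsMaxRegularIdeal M ∧ PrimeSpectrum.zeroLocus (M : Set (∀ k, R k)) ⊆ wildPrimes R}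

/-- The wild connected components of `Spec (∏ R k)`: the connected components consisting of wild
primes. -/
def wildConnectedComponents : Set (Set (PrimeSpectrum (∀ k, R k))) :=
  {C | (∃ P, C = connectedComponent P) ∧ C ⊆ wildPrimes R}

end Product

/-! A prime contains exactly one of `e` and `1 - e` for each idempotent `e`, so its idempotents
generate a max-regular ideal, the only one it contains. Modulo that ideal only trivial idempotents
survive, so its zero locus is the connected component of the prime; this gives the bijection. For
the count, a regular ideal is determined by its idempotents, of which the product has at most `2 ^
|S|`. Conversely, each nonprincipal ultrafilter is recovered from any max-regular ideal containing
its `ultrafilterIdeal`, and such an ideal is wild. An independent family of subsets supplies enough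
ultrafilters. -/

open Filter in
/-- An infinite set carries the maximal possible number of ultrafilters. -/
theorem mk_ultrafilter_of_infinite (S : Type u) [Infinite S] :
    Cardinal.mk (Ultrafilter S) = (2 : Cardinal.{u}) ^ ((2 : Cardinal.{u}) ^ Cardinal.mk S) := by
  classical
  apply le_antisymm
  · rw [← Cardinal.mk_set, ← Cardinal.mk_set]
    exact Cardinal.mk_le_of_injective (f := fun U : Ultrafilter S => {A : Set S | A ∈ U})
      fun U V h => Ultrafilter.ext fun A => Set.ext_iff.mp h A
  · have hT : Cardinal.mk (Finset S × Finset (Finset S)) = Cardinal.mk S := by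
      rw [Cardinal.mk_prod, Cardinal.mk_finset_of_infinite, Cardinal.mk_finset_of_infinite,
        Cardinal.mk_finset_of_infinite, Cardinal.lift_id, Cardinal.mul_eq_self]
      exact Cardinal.aleph0_le_mk S
    obtain ⟨φ⟩ := Cardinal.eq.mp hT
    -- Hausdorff's independent family: points of `S` code pairs `(F, G)`, and `B X` asks that the
    -- trace of `X` on `F` belong to `G`.
    let B : Set S → Set S := fun X => {s | (φ.symm s).1.filter (· ∈ X) ∈ (φ.symm s).2}
    have key (𝒜 : Set (Set S)) : ∃ U : Ultrafilter S, ∀ X, B X ∈ U ↔ X ∈ 𝒜 := by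
      obtain ⟨U, hU⟩ := Ultrafilter.exists_ultrafilter_of_finite_inter_nonempty
        (B '' 𝒜 ∪ (fun X => (B X)ᶜ) '' 𝒜ᶜ) (by
          intro T hT
          obtain ⟨P, hP, N, hN, hPN⟩ : ∃ P : Finset (Set S), (P : Set (Set S)) ⊆ 𝒜 ∧
              ∃ N : Finset (Set S), (N : Set (Set S)) ⊆ 𝒜ᶜ ∧
              ∀ Y ∈ T, (∃ X ∈ P, B X = Y) ∨ ∃ X ∈ N, (B X)ᶜ = Y := by
            have hc : ∀ Y : T, ∃ X, (X ∈ 𝒜 ∧ B X = Y) ∨ (X ∈ 𝒜ᶜ ∧ (B X)ᶜ = Y) := by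
              rintro ⟨Y, hY⟩
              rcases hT hY with ⟨X, hX, h⟩ | ⟨X, hX, h⟩
              · exact ⟨X, .inl ⟨hX, h⟩⟩
              · exact ⟨X, .inr ⟨hX, h⟩⟩
            choose g hg using hc
            refine ⟨(T.attach.image g).filter (· ∈ 𝒜), by intro X; simp,
              (T.attach.image g).filter (· ∈ 𝒜ᶜ), by intro X; simp, fun Y hY => ?_⟩
            have hm : g ⟨Y, hY⟩ ∈ T.attach.image g :=
              Finset.mem_image_of_mem _ (Finset.mem_attach _ _)
            rcases hg ⟨Y, hY⟩ with ⟨h1, h2⟩ | ⟨h1, h2⟩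
            · exact .inl ⟨_, Finset.mem_filter.mpr ⟨hm, h1⟩, h2⟩
            · exact .inr ⟨_, Finset.mem_filter.mpr ⟨hm, h1⟩, h2⟩
          have hsep : ∀ X ∈ P, ∀ Z ∈ N, ∃ s, ¬ (s ∈ X ↔ s ∈ Z) := by
            intro X hX Z hZ
            by_contra! h
            exact hN hZ (Set.ext h ▸ hP hX)
          choose! d hd using hsep
          -- `F` separates each member of `P` from each member of `N`, so no trace of the latter
          -- occurs among the traces of `P`.
          let F : Finset S := (P ×ˢ N).image fun p => d p.1 p.2
          refine ⟨φ (F, P.image fun X => F.filter (· ∈ X)), ?_⟩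
          rintro Y hY
          rcases hPN Y hY with ⟨X, hX, rfl⟩ | ⟨Z, hZ, rfl⟩
          · simpa [B] using ⟨X, hX, rfl⟩
          · simp only [B, Set.mem_compl_iff, Set.mem_ofPred_eq, Equiv.symm_apply_apply,
              Finset.mem_image, not_exists, not_and]
            intro X hX h
            have hF : d X Z ∈ F := Finset.mem_image.mpr ⟨(X, Z), by simp [hX, hZ], rfl⟩
            have := Finset.ext_iff.mp h (d X Z)
            simp only [Finset.mem_filter, hF, true_and] at this
            exact hd X hX Z hZ this)
      refine ⟨U, fun X => ⟨fun h => ?_, fun h => hU (.inl ⟨X, h, rfl⟩)⟩⟩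
      by_contra hX
      exact Ultrafilter.compl_mem_iff_notMem.mp (hU (.inr ⟨X, hX, rfl⟩)) h
    choose f hf using key
    rw [← Cardinal.mk_set, ← Cardinal.mk_set]
    refine Cardinal.mk_le_of_injective (f := f) fun 𝒜 ℬ h => Set.ext fun X => ?_
    rw [← hf, h, hf]

/-- An infinite set carries the maximal possible number of nonprincipal ultrafilters. -/
theorem mk_nonprincipal_ultrafilter (S : Type u) [Infinite S] :
    Cardinal.mk {U : Ultrafilter S | ∀ k, {k} ∉ U} =
      (2 : Cardinal.{u}) ^ ((2 : Cardinal.{u}) ^ Cardinal.mk S) := by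
  have hS : Set.range (pure : S → Ultrafilter S) = {U : Ultrafilter S | ∀ k, {k} ∉ U}ᶜ := by
    ext U
    simp only [Set.mem_range, Set.mem_compl_iff, Set.mem_ofPred_eq, not_forall, not_not]
    refine exists_congr fun k => ⟨fun h => h ▸ Ultrafilter.mem_pure.mpr rfl, fun h => ?_⟩
    exact (Ultrafilter.coe_le_coe.mp (show (U : Filter S) ≤ (pure k : Ultrafilter S) from
      Filter.le_pure_iff.mpr h)).symm
  have hinf : Infinite (Ultrafilter S) := Infinite.of_injective _ Ultrafilter.pure_injective
  -- There are at most `|S|` principal ultrafilters, too few to affect the count.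
  rw [← mk_ultrafilter_of_infinite S, ← Cardinal.mk_compl_of_infinite (Set.range (pure : S → _)),
    hS, compl_compl]
  rw [mk_ultrafilter_of_infinite]
  exact Cardinal.mk_range_le.trans_lt ((Cardinal.cantor _).trans (Cardinal.cantor _))

/-! ### Regular ideals and connected components -/

section Regular

variable {A : Type*} [CommRing A]

/-- The ideal generated by the idempotents of an ideal. -/
def Ideal.idempotentSpan (I : Ideal A) : Ideal A :=
  Ideal.span {e | IsIdempotentElem e ∧ e ∈ I}

theorem Ideal.idempotentSpan_le (I : Ideal A) : I.idempotentSpan ≤ I :=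
  Ideal.span_le.mpr fun _ he => he.2

theorem Ideal.isRegularIdeal_idempotentSpan (I : Ideal A) : IsRegularIdeal I.idempotentSpan :=
  ⟨_, fun _ he => he.1, rfl⟩

theorem IsRegularIdeal.le_idempotentSpan {I J : Ideal A} (hI : IsRegularIdeal I) (hIJ : I ≤ J) :
    I ≤ J.idempotentSpan := by
  obtain ⟨E, hE, rfl⟩ := hI
  exact Ideal.span_mono fun e he => ⟨hE e he, hIJ (Ideal.subset_span he)⟩

theorem IsRegularIdeal.idempotentSpan_eq {I : Ideal A} (hI : IsRegularIdeal I) :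
    I.idempotentSpan = I :=
  le_antisymm I.idempotentSpan_le (hI.le_idempotentSpan le_rfl)

/-- Every element of a regular ideal is fixed by an idempotent of the ideal. -/
theorem IsRegularIdeal.exists_idempotent_mul_eq {I : Ideal A} (hI : IsRegularIdeal I) {x : A}
    (hx : x ∈ I) : ∃ e ∈ I, IsIdempotentElem e ∧ e * x = x := by
  obtain ⟨E, hE, rfl⟩ := hI
  induction hx using Submodule.span_induction with
  | mem x hx => exact ⟨x, Ideal.subset_span hx, hE x hx, hE x hx⟩
  | zero => exact ⟨0, zero_mem _, IsIdempotentElem.zero, mul_zero _⟩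
  | smul a x _ ih =>
    obtain ⟨e, he, hi, h⟩ := ih
    exact ⟨e, he, hi, by rw [smul_eq_mul, mul_left_comm, h]⟩
  | add x y _ _ ihx ihy =>
    obtain ⟨e, he, hi, h⟩ := ihx
    obtain ⟨f, hf, hj, h'⟩ := ihy
    -- The join of `e` and `f`: its complement is `(1 - e) * (1 - f)`.
    refine ⟨e + f - e * f, sub_mem (add_mem he hf) (Ideal.mul_mem_right _ _ he), ?_, ?_⟩
    · unfold IsIdempotentElem at *
      linear_combination (1 - f) ^ 2 * hi + (1 - e) * hj
    · linear_combination (1 - f) * h + (1 - e) * h'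

theorem Ideal.mem_or_one_sub_mem_of_isIdempotentElem (P : Ideal A) [P.IsPrime] {e : A}
    (he : IsIdempotentElem e) : e ∈ P ∨ 1 - e ∈ P :=
  ‹P.IsPrime›.mem_or_mem (by rw [mul_sub, mul_one, he.eq, sub_self]; exact zero_mem P)

/-- An idempotent of `Q` outside `P` would have its complement in `P`, hence in `Q`, forcing `1 ∈
Q`. -/
theorem Ideal.idempotentSpan_eq_of_le (P Q : Ideal A) [P.IsPrime] [Q.IsPrime]
    (h : P.idempotentSpan ≤ Q) : P.idempotentSpan = Q.idempotentSpan := by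
  refine le_antisymm (P.isRegularIdeal_idempotentSpan.le_idempotentSpan h)
    (Ideal.span_mono fun e he => ⟨he.1, ?_⟩)
  refine (P.mem_or_one_sub_mem_of_isIdempotentElem he.1).resolve_right fun h1 => ?_
  refine (Ideal.ne_top_iff_one Q).mp ‹Q.IsPrime›.ne_top ?_
  rw [← sub_add_cancel 1 e]
  exact add_mem (h (Ideal.subset_span ⟨he.1.one_sub, h1⟩)) he.2

theorem Ideal.isMaxRegularIdeal_idempotentSpan (P : Ideal A) [hP : P.IsPrime] :
    IsMaxRegularIdeal P.idempotentSpan := by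
  refine ⟨⟨P.isRegularIdeal_idempotentSpan,
    fun h => hP.ne_top (top_le_iff.mp (h ▸ P.idempotentSpan_le))⟩, fun J hJ hle => ?_⟩
  obtain ⟨Q, hQ, hJQ⟩ := Ideal.exists_le_maximal J hJ.2
  have := hQ.isPrime
  rw [P.idempotentSpan_eq_of_le Q (hle.trans hJQ)]
  exact hJ.1.le_idempotentSpan hJQ

theorem IsMaxRegularIdeal.eq_idempotentSpan {M P : Ideal A} [hP : P.IsPrime]
    (hM : IsMaxRegularIdeal M) (h : M ≤ P) : M = P.idempotentSpan :=
  hM.eq_of_le P.isMaxRegularIdeal_idempotentSpan.prop (hM.prop.1.le_idempotentSpan h)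

theorem IsMaxRegularIdeal.exists_prime {M : Ideal A} (hM : IsMaxRegularIdeal M) :
    ∃ P : PrimeSpectrum A, M ≤ P.asIdeal := by
  obtain ⟨Q, hQ, h⟩ := Ideal.exists_le_maximal M hM.prop.2
  exact ⟨⟨Q, hQ.isPrime⟩, h⟩

theorem IsRegularIdeal.exists_le_isMaxRegularIdeal {I : Ideal A} (hI : IsRegularIdeal I)
    (h : I ≠ ⊤) : ∃ M, IsMaxRegularIdeal M ∧ I ≤ M := by
  obtain ⟨Q, hQ, hIQ⟩ := Ideal.exists_le_maximal I h
  have := hQ.isPrime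
  exact ⟨_, Q.isMaxRegularIdeal_idempotentSpan, hI.le_idempotentSpan hIQ⟩

theorem PrimeSpectrum.isPreconnected_zeroLocus_idempotentSpan (P : PrimeSpectrum A) :
    IsPreconnected (zeroLocus (P.asIdeal.idempotentSpan : Set A)) := by
  set I := P.asIdeal.idempotentSpan
  have hreg : IsRegularIdeal I := P.asIdeal.isRegularIdeal_idempotentSpan
  have hconn : PreconnectedSpace (PrimeSpectrum (A ⧸ I)) := by
    rw [preconnectedSpace_iff_clopen]
    intro s hs
    obtain ⟨f, hf, rfl⟩ := isClopen_iff.mp hs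
    obtain ⟨r, rfl⟩ := Ideal.Quotient.mk_surjective f
    have hr : r * r - r ∈ I := by
      rw [← Ideal.Quotient.eq_zero_iff_mem, map_sub, map_mul, hf.eq, sub_self]
    -- Idempotents lift: `1 - e` kills `r * r - r`, so `r * (1 - e)` is an idempotent congruent to
    -- `r`.
    obtain ⟨e, heI, he, her⟩ := hreg.exists_idempotent_mul_eq hr
    have hmk : Ideal.Quotient.mk I r = Ideal.Quotient.mk I (r * (1 - e)) := by
      rw [map_mul, map_sub, Ideal.Quotient.eq_zero_iff_mem.mpr heI, map_one, sub_zero, mul_one]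
    have ht : IsIdempotentElem (r * (1 - e)) := by
      unfold IsIdempotentElem at *
      linear_combination r ^ 2 * he - her
    rw [hmk]
    rcases P.asIdeal.mem_or_one_sub_mem_of_isIdempotentElem ht with h | h
    · left
      have h0 : Ideal.Quotient.mk I (r * (1 - e)) = 0 :=
        Ideal.Quotient.eq_zero_iff_mem.mpr (Ideal.subset_span ⟨ht, h⟩)
      rw [h0]
      simp
    · right
      have h1 : Ideal.Quotient.mk I (1 - r * (1 - e)) = 0 :=
        Ideal.Quotient.eq_zero_iff_mem.mpr (Ideal.subset_span ⟨ht.one_sub, h⟩)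
      rw [map_sub, map_one, sub_eq_zero] at h1
      rw [← h1]
      simp
  have hrange := range_comap_of_surjective _ (Ideal.Quotient.mk I) Ideal.Quotient.mk_surjective
  rw [Ideal.mk_ker] at hrange
  rw [← hrange]
  exact isPreconnected_range (continuous_comap _)

/-- The connected component of a prime is cut out by its idempotents. -/
theorem PrimeSpectrum.zeroLocus_idempotentSpan_eq_connectedComponent (P : PrimeSpectrum A) :
    zeroLocus (P.asIdeal.idempotentSpan : Set A) = connectedComponent P := by
  refine subset_antisymm ((isPreconnected_zeroLocus_idempotentSpan P).subset_connectedComponent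
    P.asIdeal.idempotentSpan_le) ?_
  rw [Ideal.idempotentSpan, zeroLocus_span]
  intro Q hQ e he
  have hc : IsClopen (zeroLocus {e} : Set (PrimeSpectrum A)) :=
    isClopen_iff_zeroLocus.mpr ⟨e, he.1, rfl⟩
  exact hc.connectedComponent_subset (Set.singleton_subset_iff.mpr he.2) hQ rfl

end Regular

/-! ### Wild max-regular ideals of the product -/

section Product

variable {S : Type u} (R : S → Type v) [∀ k, CommRing (R k)]

theorem bijOn_zeroLocus_wildMaxRegularIdeals :
    Set.BijOn (fun M : Ideal (∀ k, R k) => PrimeSpectrum.zeroLocus (M : Set (∀ k, R k)))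
      (wildMaxRegularIdeals R) (wildConnectedComponents R) := by
  refine ⟨?_, ?_, ?_⟩
  · rintro M ⟨hM, hw⟩
    obtain ⟨P, hP⟩ := hM.exists_prime
    refine ⟨⟨P, ?_⟩, hw⟩
    rw [← PrimeSpectrum.zeroLocus_idempotentSpan_eq_connectedComponent,
      ← hM.eq_idempotentSpan hP]
  · rintro M ⟨hM, -⟩ N ⟨hN, -⟩ h
    obtain ⟨P, hP⟩ := hM.exists_prime
    have hP' : P ∈ PrimeSpectrum.zeroLocus (N : Set (∀ k, R k)) :=
      (Set.ext_iff.mp h P).mp hP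
    rw [hM.eq_idempotentSpan hP, hN.eq_idempotentSpan hP']
  · rintro _ ⟨⟨P, rfl⟩, hw⟩
    have h := PrimeSpectrum.zeroLocus_idempotentSpan_eq_connectedComponent P
    exact ⟨_, ⟨P.asIdeal.isMaxRegularIdeal_idempotentSpan, h ▸ hw⟩, h⟩

open Classical in
/-- The idempotent of the product which is `1` on `B` and `0` elsewhere. -/
noncomputable def indicatorIdempotent (B : Set S) : ∀ k, R k :=
  fun k => if k ∈ B then 1 else 0

theorem indicatorIdempotent_apply_of_mem {B : Set S} {k : S} (h : k ∈ B) :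
    indicatorIdempotent R B k = 1 :=
  if_pos h

theorem indicatorIdempotent_apply_of_notMem {B : Set S} {k : S} (h : k ∉ B) :
    indicatorIdempotent R B k = 0 :=
  if_neg h

theorem isIdempotentElem_indicatorIdempotent (B : Set S) :
    IsIdempotentElem (indicatorIdempotent R B) := by
  funext k
  by_cases h : k ∈ B <;> simp [indicatorIdempotent, h]

theorem indicatorIdempotent_add_compl (B : Set S) :
    indicatorIdempotent R B + indicatorIdempotent R Bᶜ = 1 := by
  funext k
  by_cases h : k ∈ B <;> simp [indicatorIdempotent, h]

/-- The regular ideal of the product attached to an ultrafilter on the index set. -/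
def ultrafilterIdeal (U : Ultrafilter S) : Ideal (∀ k, R k) :=
  Ideal.span (indicatorIdempotent R '' {B | B ∉ U})

theorem isRegularIdeal_ultrafilterIdeal (U : Ultrafilter S) :
    IsRegularIdeal (ultrafilterIdeal R U) :=
  ⟨_, by rintro _ ⟨B, -, rfl⟩; exact isIdempotentElem_indicatorIdempotent R B, rfl⟩

theorem indicatorIdempotent_mem_ultrafilterIdeal {U : Ultrafilter S} {B : Set S} (h : B ∉ U) :
    indicatorIdempotent R B ∈ ultrafilterIdeal R U :=
  Ideal.subset_span ⟨B, h, rfl⟩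

theorem eventually_eq_zero_of_mem_ultrafilterIdeal {U : Ultrafilter S} {x : ∀ k, R k}
    (hx : x ∈ ultrafilterIdeal R U) : ∀ᶠ k in (U : Filter S), x k = 0 := by
  induction hx using Submodule.span_induction with
  | mem x hx =>
    obtain ⟨B, hB, rfl⟩ := hx
    filter_upwards [Ultrafilter.compl_mem_iff_notMem.mpr hB] with k hk
    exact indicatorIdempotent_apply_of_notMem R hk
  | zero => exact .of_forall fun _ => rfl
  | smul a x _ ih =>
    filter_upwards [ih] with k hk
    simp [hk]
  | add x y _ _ ihx ihy =>
    filter_upwards [ihx, ihy] with k hx hy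
    simp [hx, hy]

theorem ultrafilterIdeal_ne_top [∀ k, Nontrivial (R k)] (U : Ultrafilter S) :
    ultrafilterIdeal R U ≠ ⊤ := by
  intro h
  obtain ⟨k, hk⟩ := (eventually_eq_zero_of_mem_ultrafilterIdeal R
    ((Ideal.eq_top_iff_one _).mp h)).exists
  exact one_ne_zero hk

/-- An ultrafilter is determined by any proper ideal containing its regular ideal. -/
theorem indicatorIdempotent_mem_iff {U : Ultrafilter S} {M : Ideal (∀ k, R k)} (hM : M ≠ ⊤)
    (h : ultrafilterIdeal R U ≤ M) (B : Set S) : indicatorIdempotent R B ∈ M ↔ B ∉ U := by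
  refine ⟨fun hB hU => hM ((Ideal.eq_top_iff_one M).mpr ?_),
    fun hB => h (indicatorIdempotent_mem_ultrafilterIdeal R hB)⟩
  rw [← indicatorIdempotent_add_compl R B]
  exact add_mem hB (h (indicatorIdempotent_mem_ultrafilterIdeal R
    (Ultrafilter.compl_notMem_iff.mpr hU)))

/-- A tame prime over `k` cannot contain the indicator of `{k}`, whose value at `k` is `1`. -/
theorem zeroLocus_subset_wildPrimes {U : Ultrafilter S} (hU : ∀ k, {k} ∉ U)
    {M : Ideal (∀ k, R k)} (h : ultrafilterIdeal R U ≤ M) :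
    PrimeSpectrum.zeroLocus (M : Set (∀ k, R k)) ⊆ wildPrimes R := by
  rintro _ hP ⟨k, p, rfl⟩
  have hk : indicatorIdempotent R {k} k ∈ p.asIdeal :=
    hP (h (indicatorIdempotent_mem_ultrafilterIdeal R (hU k)))
  rw [indicatorIdempotent_apply_of_mem R (Set.mem_singleton k)] at hk
  exact p.isPrime.ne_top ((Ideal.eq_top_iff_one _).mpr hk)

theorem lift_two_power_le_mk_wildMaxRegularIdeals [Infinite S] [∀ k, Nontrivial (R k)] :
    Cardinal.lift.{v} ((2 : Cardinal.{u}) ^ ((2 : Cardinal.{u}) ^ Cardinal.mk S)) ≤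
      Cardinal.mk (wildMaxRegularIdeals R) := by
  have hex (U : Ultrafilter S) := (isRegularIdeal_ultrafilterIdeal R
    U).exists_le_isMaxRegularIdeal (ultrafilterIdeal_ne_top R U)
  choose M hM hle using hex
  rw [← mk_nonprincipal_ultrafilter S, ← Cardinal.lift_id'.{u, max u v} (Cardinal.mk _),
    Cardinal.lift_umax.{u, v}.symm]
  refine Cardinal.lift_mk_le'.mpr ⟨⟨fun U => ⟨M U, hM U, zeroLocus_subset_wildPrimes R U.2
    (hle U)⟩, fun U V h => Subtype.ext (Ultrafilter.ext fun B => ?_)⟩⟩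
  have hUV : M U = M V := congrArg Subtype.val h
  rw [← not_iff_not, ← indicatorIdempotent_mem_iff R (hM U).prop.2 (hle U), hUV,
    indicatorIdempotent_mem_iff R (hM V).prop.2 (hle V)]

theorem mk_idempotents_pi_le [Infinite S] [∀ k, Nontrivial (R k)]
    (hfin : ∀ k, {e : R k | IsIdempotentElem e}.Finite) :
    Cardinal.mk {e : ∀ k, R k | IsIdempotentElem e} ≤
      Cardinal.lift.{v} ((2 : Cardinal.{u}) ^ Cardinal.mk S) := by
  -- Each factor has at least two idempotents and at most `|S|`, so the product of these numbers is
  -- `2 ^ |S|`.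
  rw [Cardinal.lift_two_power, ← Cardinal.prod_eq_two_power
    (c := fun k => Cardinal.mk {e : R k | IsIdempotentElem e}), ← Cardinal.mk_pi]
  · exact Cardinal.mk_le_of_injective
      (f := fun e k => (⟨e.1 k, congrFun e.2 k⟩ : {e : R k | IsIdempotentElem e}))
      fun e f h => Subtype.ext (funext fun k => congrArg Subtype.val (congrFun h k))
  · intro k
    rw [Cardinal.two_le_iff]
    exact ⟨⟨0, IsIdempotentElem.zero⟩, ⟨1, IsIdempotentElem.one⟩,
      fun h => zero_ne_one (congrArg Subtype.val h)⟩
  · intro k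
    have := (Cardinal.lt_aleph0_iff_set_finite.mpr (hfin k)).le
    exact (Cardinal.lift_le_aleph0.mpr this).trans
      (Cardinal.aleph0_le_lift.mpr (Cardinal.aleph0_le_mk S))

theorem mk_wildMaxRegularIdeals_le [Infinite S] [∀ k, Nontrivial (R k)]
    (hfin : ∀ k, {e : R k | IsIdempotentElem e}.Finite) :
    Cardinal.mk (wildMaxRegularIdeals R) ≤
      Cardinal.lift.{v} ((2 : Cardinal.{u}) ^ ((2 : Cardinal.{u}) ^ Cardinal.mk S)) := by
  rw [Cardinal.lift_two_power]
  refine le_trans ?_ (Cardinal.power_le_power_left two_ne_zero (mk_idempotents_pi_le R hfin))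
  rw [← Cardinal.mk_set]
  refine Cardinal.mk_le_of_injective (f := fun M => {e | e.1 ∈ M.1}) fun M N h => ?_
  refine Subtype.ext ?_
  rw [← M.2.1.prop.1.idempotentSpan_eq, ← N.2.1.prop.1.idempotentSpan_eq]
  refine congrArg Ideal.span (Set.ext fun e => and_congr_right fun he => ?_)
  exact Set.ext_iff.mp h ⟨e, he⟩

end Product

theorem mainTheorem10 {S : Type u} [Infinite S] (R : S → Type v) [∀ k, CommRing (R k)]
    [∀ k, Nontrivial (R k)] (hfin : ∀ k, {e : R k | IsIdempotentElem e}.Finite) :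
    Cardinal.mk (wildMaxRegularIdeals R) =
        Cardinal.lift.{v} ((2 : Cardinal.{u}) ^ ((2 : Cardinal.{u}) ^ Cardinal.mk S)) ∧
      Set.BijOn (fun M : Ideal (∀ k, R k) => PrimeSpectrum.zeroLocus (M : Set (∀ k, R k)))
        (wildMaxRegularIdeals R) (wildConnectedComponents R) ∧
      Cardinal.mk (wildConnectedComponents R) =
        Cardinal.lift.{v} ((2 : Cardinal.{u}) ^ ((2 : Cardinal.{u}) ^ Cardinal.mk S)) := by
  have hcard := (mk_wildMaxRegularIdeals_le R hfin).antisymm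
    (lift_two_power_le_mk_wildMaxRegularIdeals R)
  have hbij := bijOn_zeroLocus_wildMaxRegularIdeals R
  exact ⟨hcard, hbij, (Cardinal.mk_congr (hbij.equiv _)).symm.trans hcard⟩
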